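/- For $t\in\mathbb{R}$ let $\|t\|=\min_{n\in\mathbb{Z}}|t-n|$ denote the distance from $t$ to the nearest integer. Let $\psi:\{1,2,3,\dots\}\to(0,\infty)$ be a non-increasing function such that \[ \sum_{q=1}^{\infty}\psi(q)\log q=\infty . \] Let $\gamma$ be a real number that is not a Liouville number, and let $\gamma'$ be any real number. (A real number $x$ is a Liouville number if for every integer $n\ge 0$ there are integers $a,b$ with $b\ge 2$ and $0<|x-a/b|<b^{-n}$; in particular every rational number is non-Liouville.) Then for Lebesgue almost every $(x,y)\in[0,1]^2$ there are infinitely many positive integers $q$ such that \[ \|qx-\gamma\|\,\|qy-\gamma'\|\le\psi(q). \] -/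

import Mathlib

/-- `‖x‖`: the distance from the real number `x` to the set of integers. -/
noncomputable def distToInt (x : ℝ) : ℝ :=
  Metric.infDist x (Set.range ((↑) : ℤ → ℝ))

theorem distToInt_eq_abs_sub_round (x : ℝ) : distToInt x = |x - round x| := by
  unfold distToInt
  apply le_antisymm
  · rw [← Real.dist_eq]
    exact Metric.infDist_le_dist_of_mem ⟨round x, rfl⟩
  · refine (Metric.le_infDist (Set.range_nonempty _)).2 ?_
    rintro _ ⟨n, rfl⟩
    rw [Real.dist_eq]
    exact round_le x n

/-- An approximation function: a positive function of the positive integers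
(the value at `0` plays no role). -/
def IsApproximationFunction (ψ : ℕ → ℝ) : Prop :=
  ∀ q : ℕ, 1 ≤ q → 0 < ψ q

open MeasureTheory ProbabilityTheory Filter Topology

/-! Work on the torus and first cut `ψ` down to `1 / (4 * q)`. For each `q` and each dyadic scale `2
^ i` between about `q ^ (1/4)` and `q ^ (1/2)`, the rectangle condition `‖qx - γ‖ ≤ ψ q * 2 ^ i`,
`‖qy - γ'‖ ≤ 2 ^ (-i)` implies the desired inequality. It has probability exactly `4 * ψ q`, and
about `log q` scales are available, so the expected number of pairs `(q, i)` that occur diverges. By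
Chebyshev it suffices that the variance is at most linear in the mean
(`ae_infinite_of_sum_measureReal_inter_le`); this gives full measure at once, with no zero-one law.

On each circle the correlation of two conditions exceeds independence by at most `2 * gcd q r * min
(δ / q) (ε / r)` (`measureReal_nearSet_inter_le`). Multiplying the two coordinates leaves three
errors. The two mixed ones are where the scales must stay away from both ends: summed over scales
they are `O((q * r) ^ (-17/16))`, which is summable against the gcd. The error with a gcd in both
coordinates depends on the scales through a two-sided geometric sum, and reduces to the quadratic
form `gcd ^ 2 / (q * r)` at the square roots of `ψ q * scaleCount q`. Monotonicity of `ψ` keeps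
these weights from concentrating on multiples of a fixed integer, so the form is linear in the mean
(`exists_sum_gcd_sq_mul_sqrt_le`). -/

/-! ### Pair correlations on the circle. -/

/-- An arithmetic progression of `r` points with step `q / r` on the circle meets an arc of
length `2 * δ` in at most `2 * δ * r + gcd q r` points. -/
theorem card_norm_add_mul_div_le (q r : ℕ) (hr : 0 < r) (t δ : ℝ) (hδ : 0 ≤ δ) :
    (((Finset.range r).filter fun m : ℕ =>
      ‖((t + q * m / r : ℝ) : UnitAddCircle)‖ ≤ δ).card : ℝ) ≤ 2 * δ * r + Nat.gcd q r := by
  obtain ⟨g, hg⟩ : ∃ g, g = Nat.gcd q r := ⟨_, rfl⟩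
  have hgpos : 0 < g := hg ▸ Nat.gcd_pos_of_pos_right q hr
  obtain ⟨a, ha⟩ : g ∣ q := hg ▸ Nat.gcd_dvd_left q r
  obtain ⟨b, hb⟩ : g ∣ r := hg ▸ Nat.gcd_dvd_right q r
  have hbpos : 0 < b := Nat.pos_of_mul_pos_left (hb ▸ hr)
  have hcop : Nat.Coprime a b := by
    have h1 : Nat.gcd (g * a) (g * b) = g := by rw [← ha, ← hb, ← hg]
    rw [Nat.gcd_mul_left] at h1
    exact Nat.eq_of_mul_eq_mul_left hgpos (by simpa using h1)
  rw [← hg]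
  have hgR : (0 : ℝ) < g := by exact_mod_cast hgpos
  have hbR : (0 : ℝ) < b := by exact_mod_cast hbpos
  have hquot : ∀ m : ℕ, (q * m / r : ℝ) = a * m / b := by
    intro m
    rw [ha, hb]
    push_cast
    field_simp
  -- `f m / b` is the lift of `a * m / b` that brings its translate by `t` nearest to `0`, so good
  -- `m` give integers in an interval of length `2 * b * δ`. Each value determines `m` modulo `b`,
  -- hence is taken at most `g` times.
  let f : ℕ → ℤ := fun m => a * m - round (t + a * m / b : ℝ) * b
  have hmaps : ∀ m ∈ (Finset.range r).filter fun m : ℕ =>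
      ‖((t + q * m / r : ℝ) : UnitAddCircle)‖ ≤ δ,
      f m ∈ Finset.Icc ⌈b * (-δ - t)⌉ ⌊b * (δ - t)⌋ := by
    intro m hm
    have h := (Finset.mem_filter.mp hm).2
    rw [hquot, UnitAddCircle.norm_eq, abs_le] at h
    have hf : ((f m : ℤ) : ℝ) = b * (t + a * m / b - round (t + a * m / b : ℝ)) - b * t := by
      simp only [f]
      push_cast
      field_simp
      ring
    rw [Finset.mem_Icc, Int.ceil_le, Int.le_floor, hf]
    constructor
    · nlinarith [mul_le_mul_of_nonneg_left h.1 hbR.le]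
    · nlinarith [mul_le_mul_of_nonneg_left h.2 hbR.le]
  have hfiber : ∀ z ∈ Finset.Icc ⌈b * (-δ - t)⌉ ⌊b * (δ - t)⌋,
      (((Finset.range r).filter fun m : ℕ =>
        ‖((t + q * m / r : ℝ) : UnitAddCircle)‖ ≤ δ).filter fun m => f m = z).card ≤ g := by
    intro z _
    rw [← Finset.card_range g]
    refine Finset.card_le_card_of_injOn (fun m => m / b) ?_ ?_
    · intro m hm
      simp only [Finset.coe_filter, Finset.mem_filter, Finset.mem_range, Set.mem_ofPred_eq] at hm
      simp only [Finset.coe_range, Set.mem_Iio]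
      rw [Nat.div_lt_iff_lt_mul hbpos, ← hb]
      exact hm.1.1
    · intro m hm m' hm' hmm
      simp only [Finset.coe_filter, Finset.mem_filter, Finset.mem_range, Set.mem_ofPred_eq]
        at hm hm'
      have h1 : (b : ℤ) ∣ a * ((m : ℤ) - m') := by
        have h2 := hm.2.trans hm'.2.symm
        simp only [f] at h2
        exact ⟨round (t + a * m / b : ℝ) - round (t + a * m' / b : ℝ), by linear_combination h2⟩
      have h3 : (b : ℤ) ∣ (m : ℤ) - m' :=
        IsCoprime.dvd_of_dvd_mul_left (Nat.isCoprime_iff_coprime.mpr hcop.symm) h1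
      have h4 : m' ≡ m [MOD b] := (Nat.modEq_iff_dvd).mpr h3
      have h5 : m' % b = m % b := h4
      have h6 : m / b = m' / b := hmm
      rw [← Nat.div_add_mod m b, ← Nat.div_add_mod m' b, h5, h6]
  have hcard := Finset.card_le_mul_card_image_of_maps_to hmaps g hfiber
  rw [Int.card_Icc] at hcard
  have hw : (((⌊b * (δ - t)⌋ + 1 - ⌈b * (-δ - t)⌉).toNat : ℕ) : ℝ) ≤ 2 * b * δ + 1 := by
    have h1 := Int.floor_le (b * (δ - t))
    have h2 := Int.le_ceil (b * (-δ - t))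
    rcases le_total 0 (⌊b * (δ - t)⌋ + 1 - ⌈b * (-δ - t)⌉) with h | h
    · have h3 : (((⌊b * (δ - t)⌋ + 1 - ⌈b * (-δ - t)⌉).toNat : ℤ) : ℝ)
          = ((⌊b * (δ - t)⌋ + 1 - ⌈b * (-δ - t)⌉ : ℤ) : ℝ) := by rw [Int.toNat_of_nonneg h]
      rw [Int.cast_natCast] at h3
      rw [h3]
      push_cast
      linarith
    · rw [Int.toNat_of_nonpos h]
      push_cast
      positivity
  calc _ ≤ ((g * (⌊b * (δ - t)⌋ + 1 - ⌈b * (-δ - t)⌉).toNat : ℕ) : ℝ) := by exact_mod_cast hcard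
    _ ≤ g * (2 * b * δ + 1) := by
      push_cast
      gcongr
    _ = 2 * δ * r + g := by
      rw [hb]
      push_cast
      ring

/-- The points `x` of the circle whose multiple `q • x` lies within `δ` of `c`. -/
def nearSet (c : UnitAddCircle) (q : ℕ) (δ : ℝ) : Set UnitAddCircle :=
  {x | ‖q • x - c‖ ≤ δ}

theorem measurableSet_nearSet (c : UnitAddCircle) (q : ℕ) (δ : ℝ) :
    MeasurableSet (nearSet c q δ) := by
  apply IsClosed.measurableSet
  exact isClosed_le (by fun_prop) continuous_const

theorem measureReal_nearSet (c : UnitAddCircle) {q : ℕ} (hq : 0 < q) {δ : ℝ} (h0 : 0 ≤ δ)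
    (h1 : 2 * δ ≤ 1) : (volume : Measure UnitAddCircle).real (nearSet c q δ) = 2 * δ := by
  have hpre : nearSet c q δ = (fun x : UnitAddCircle => (q : ℤ) • x) ⁻¹' Metric.closedBall c δ := by
    ext x
    simp [nearSet, dist_eq_norm]
  have hmp : MeasurePreserving (fun x : UnitAddCircle => (q : ℤ) • x) volume volume :=
    Measure.measurePreserving_zsmul volume (by exact_mod_cast hq.ne')
  rw [Measure.real, hpre, hmp.measure_preimage Metric.isClosed_closedBall.measurableSet.nullMeasurableSet,
    AddCircle.volume_closedBall, min_eq_right h1, ENNReal.toReal_ofReal (by positivity)]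

/-- The second set is invariant under translation by `1 / r`, so the first may be averaged over its
`r` translates. Each point lies in at most `2 * δ * r + gcd q r` of them, by the progression count.
-/
theorem volume_nearSet_inter_le (c : UnitAddCircle) {q r : ℕ} (hr : 0 < r) {δ ε : ℝ}
    (hδ : 0 ≤ δ) :
    r * (volume : Measure UnitAddCircle).real (nearSet c q δ ∩ nearSet c r ε) ≤
      (2 * δ * r + Nat.gcd q r) * (volume : Measure UnitAddCircle).real (nearSet c r ε) := by
  set A := nearSet c q δ
  set B := nearSet c r ε
  have hA : MeasurableSet A := measurableSet_nearSet c q δ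
  have hB : MeasurableSet B := measurableSet_nearSet c r ε
  have hrR : (0 : ℝ) < r := by exact_mod_cast hr
  let τ : ℕ → UnitAddCircle := fun m => ((m / r : ℝ) : UnitAddCircle)
  have hτ : ∀ m, r • τ m = 0 := by
    intro m
    simp only [τ]
    rw [← AddCircle.coe_nsmul, nsmul_eq_mul, mul_div_cancel₀ _ hrR.ne']
    exact (AddCircle.coe_eq_zero_iff (1 : ℝ)).mpr ⟨m, by simp⟩
  have hBinv : ∀ m, (fun x => x + τ m) ⁻¹' B = B := by
    intro m
    ext x
    simp [B, nearSet, hτ]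
  have hshift : ∀ m, volume (A ∩ B) = volume ((fun x => x + τ m) ⁻¹' A ∩ B) := by
    intro m
    rw [← measure_preimage_add_right volume (τ m) (A ∩ B), Set.preimage_inter, hBinv]
  have hcount : ∀ x : UnitAddCircle,
      ∑ m ∈ Finset.range r, ((fun x => x + τ m) ⁻¹' A).indicator (fun _ => (1 : ENNReal)) x ≤
        ENNReal.ofReal (2 * δ * r + Nat.gcd q r) := by
    intro x
    obtain ⟨s, hs⟩ : ∃ s : ℝ, (s : UnitAddCircle) = q • x - c := QuotientAddGroup.mk_surjective _
    have hmem : ∀ m, x ∈ (fun x => x + τ m) ⁻¹' A ↔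
        ‖((s + q * m / r : ℝ) : UnitAddCircle)‖ ≤ δ := by
      intro m
      have : ((s + q * m / r : ℝ) : UnitAddCircle) = q • (x + τ m) - c := by
        rw [AddCircle.coe_add, hs, smul_add, mul_div_assoc, ← nsmul_eq_mul, AddCircle.coe_nsmul]
        abel
      rw [this]
      rfl
    classical
    simp only [Set.indicator_apply, hmem]
    rw [← Finset.sum_filter, Finset.sum_const, nsmul_eq_mul, mul_one,
      ← ENNReal.ofReal_natCast]
    exact ENNReal.ofReal_le_ofReal (card_norm_add_mul_div_le q r hr s δ hδ)
  have hmain : (r : ENNReal) * volume (A ∩ B) ≤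
      ENNReal.ofReal (2 * δ * r + Nat.gcd q r) * volume B := by
    calc (r : ENNReal) * volume (A ∩ B)
        = ∑ m ∈ Finset.range r, volume ((fun x => x + τ m) ⁻¹' A ∩ B) := by
          rw [← Finset.sum_congr rfl fun m _ => hshift m]
          simp
      _ = ∑ m ∈ Finset.range r, ∫⁻ x in B,
            ((fun x => x + τ m) ⁻¹' A).indicator (fun _ => (1 : ENNReal)) x := by
          refine Finset.sum_congr rfl fun m _ => ?_
          have hm : MeasurableSet ((fun x => x + τ m) ⁻¹' A) := (measurable_add_const _) hA
          rw [lintegral_indicator hm, setLIntegral_one, Measure.restrict_apply hm]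
      _ = ∫⁻ x in B, ∑ m ∈ Finset.range r,
            ((fun x => x + τ m) ⁻¹' A).indicator (fun _ => (1 : ENNReal)) x := by
          rw [lintegral_finsetSum]
          intro m _
          exact measurable_const.indicator ((measurable_add_const _) hA)
      _ ≤ ∫⁻ _ in B, ENNReal.ofReal (2 * δ * r + Nat.gcd q r) := lintegral_mono hcount
      _ = _ := by simp
  have := ENNReal.toReal_mono (by finiteness) hmain
  rwa [ENNReal.toReal_mul, ENNReal.toReal_mul, ENNReal.toReal_natCast,
    ENNReal.toReal_ofReal (by positivity)] at this

/-- The correlation of two such sets exceeds the product of their measures by at most a term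
governed by the greatest common divisor. -/
theorem measureReal_nearSet_inter_le (c : UnitAddCircle) {q r : ℕ} (hq : 0 < q) (hr : 0 < r)
    {δ ε : ℝ} (hδ : 0 ≤ δ) (hδ' : 2 * δ ≤ 1) (hε : 0 ≤ ε) (hε' : 2 * ε ≤ 1) :
    (volume : Measure UnitAddCircle).real (nearSet c q δ ∩ nearSet c r ε) ≤
      4 * (δ * ε) + 2 * (Nat.gcd q r * min (δ / q) (ε / r)) := by
  have hqR : (0 : ℝ) < q := by exact_mod_cast hq
  have hrR : (0 : ℝ) < r := by exact_mod_cast hr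
  have h1 := volume_nearSet_inter_le c (q := q) (ε := ε) hr hδ
  have h2 := volume_nearSet_inter_le c (q := r) (ε := δ) hq hε
  rw [measureReal_nearSet c hr hε hε'] at h1
  rw [measureReal_nearSet c hq hδ hδ', Set.inter_comm, Nat.gcd_comm] at h2
  rw [mul_min_of_nonneg _ _ (Nat.cast_nonneg _), mul_min_of_nonneg _ _ zero_le_two,
    ← min_add_add_left]
  refine le_min ?_ ?_
  · rw [← mul_le_mul_iff_right₀ hqR]
    refine h2.trans (le_of_eq ?_)
    field_simp
    ring
  · rw [← mul_le_mul_iff_right₀ hrR]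
    refine h1.trans (le_of_eq ?_)
    field_simp
    ring

/-! ### Gcd sums. -/

/-- Sums over pairs, reorganised by greatest common divisor and coprime cofactors. -/
theorem sum_sum_gcd_le (N : ℕ) (G : ℕ → ℕ → ℕ → ℝ) (hG : ∀ g a b, 0 ≤ G g a b) :
    ∑ q ∈ Finset.Icc 1 N, ∑ r ∈ Finset.Icc 1 N,
      G (Nat.gcd q r) (q / Nat.gcd q r) (r / Nat.gcd q r) ≤
    ∑ a ∈ Finset.Icc 1 N, ∑ b ∈ Finset.Icc 1 N, ∑ g ∈ Finset.Icc 1 N, G g a b := by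
  classical
  let φ : ℕ × ℕ → ℕ × ℕ × ℕ := fun p =>
    (p.1 / Nat.gcd p.1 p.2, p.2 / Nat.gcd p.1 p.2, Nat.gcd p.1 p.2)
  have hφ : Set.InjOn φ (Finset.Icc 1 N ×ˢ Finset.Icc 1 N : Finset (ℕ × ℕ)) := by
    rintro ⟨q, r⟩ - ⟨q', r'⟩ - h
    simp only [φ, Prod.mk.injEq] at h
    obtain ⟨h1, h2, h3⟩ := h
    ext
    · change q = q'
      rw [← Nat.div_mul_cancel (Nat.gcd_dvd_left q r), h1, h3,
        Nat.div_mul_cancel (Nat.gcd_dvd_left q' r')]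
    · change r = r'
      rw [← Nat.div_mul_cancel (Nat.gcd_dvd_right q r), h2, h3,
        Nat.div_mul_cancel (Nat.gcd_dvd_right q' r')]
  have hsub : (Finset.Icc 1 N ×ˢ Finset.Icc 1 N).image φ ⊆
      Finset.Icc 1 N ×ˢ Finset.Icc 1 N ×ˢ Finset.Icc 1 N := by
    intro x hx
    obtain ⟨⟨q, r⟩, hp, rfl⟩ := Finset.mem_image.mp hx
    simp only [Finset.mem_product, Finset.mem_Icc] at hp
    obtain ⟨⟨hq1, hqN⟩, hr1, hrN⟩ := hp
    have hg : 0 < Nat.gcd q r := Nat.gcd_pos_of_pos_left r hq1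
    simp only [φ, Finset.mem_product, Finset.mem_Icc]
    exact ⟨⟨Nat.div_pos (Nat.gcd_le_left r hq1) hg, (Nat.div_le_self _ _).trans hqN⟩,
      ⟨Nat.div_pos (Nat.gcd_le_right q hr1) hg, (Nat.div_le_self _ _).trans hrN⟩,
      hg, (Nat.gcd_le_left r hq1).trans hqN⟩
  calc _ = ∑ p ∈ Finset.Icc 1 N ×ˢ Finset.Icc 1 N, G (φ p).2.2 (φ p).1 (φ p).2.1 := by
        rw [Finset.sum_product]
    _ = ∑ x ∈ (Finset.Icc 1 N ×ˢ Finset.Icc 1 N).image φ, G x.2.2 x.1 x.2.1 := by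
        rw [Finset.sum_image hφ]
    _ ≤ ∑ x ∈ Finset.Icc 1 N ×ˢ Finset.Icc 1 N ×ˢ Finset.Icc 1 N, G x.2.2 x.1 x.2.1 :=
        Finset.sum_le_sum_of_subset_of_nonneg hsub fun _ _ _ => hG _ _ _
    _ = _ := by
        rw [Finset.sum_product]
        refine Finset.sum_congr rfl fun a _ => ?_
        rw [Finset.sum_product]

theorem exists_sum_rpow_neg_le {s : ℝ} (hs : 1 < s) :
    ∃ C : ℝ, 0 ≤ C ∧ ∀ N : ℕ, ∑ n ∈ Finset.Icc 1 N, (n : ℝ) ^ (-s) ≤ C := by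
  have hsum : Summable fun n : ℕ => (n : ℝ) ^ (-s) := Real.summable_nat_rpow.mpr (by linarith)
  exact ⟨∑' n : ℕ, (n : ℝ) ^ (-s), tsum_nonneg fun n => by positivity,
    fun N => hsum.sum_le_tsum _ fun n _ => by positivity⟩

/-- Writing `q = g * a`, `r = g * b` turns the summand into `a ^ (-s) * b ^ (-s) * g ^ (1 - 2 * s)`,
and all three exponents are below `-1`. -/
theorem exists_sum_gcd_mul_rpow_le {s : ℝ} (hs : 1 < s) :
    ∃ C : ℝ, 0 ≤ C ∧ ∀ N : ℕ, ∑ q ∈ Finset.Icc 1 N, ∑ r ∈ Finset.Icc 1 N,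
      (Nat.gcd q r : ℝ) * ((q : ℝ) * r) ^ (-s) ≤ C := by
  obtain ⟨A, hA0, hA⟩ := exists_sum_rpow_neg_le hs
  obtain ⟨B, hB0, hB⟩ := exists_sum_rpow_neg_le (s := 2 * s - 1) (by linarith)
  refine ⟨A * (A * B), by positivity, fun N => ?_⟩
  have key := sum_sum_gcd_le N (fun g a b => (g : ℝ) * (((g * a : ℕ) : ℝ) * ((g * b : ℕ) : ℝ)) ^ (-s))
    (fun g a b => by positivity)
  refine le_trans (le_of_eq ?_) (key.trans ?_)
  · refine Finset.sum_congr rfl fun q _ => Finset.sum_congr rfl fun r _ => ?_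
    rw [Nat.mul_div_cancel' (Nat.gcd_dvd_left q r), Nat.mul_div_cancel' (Nat.gcd_dvd_right q r)]
  · calc _ = ∑ a ∈ Finset.Icc 1 N, ∑ b ∈ Finset.Icc 1 N, ∑ g ∈ Finset.Icc 1 N,
          (a : ℝ) ^ (-s) * ((b : ℝ) ^ (-s) * (g : ℝ) ^ (-(2 * s - 1))) := by
          refine Finset.sum_congr rfl fun a _ => Finset.sum_congr rfl fun b _ =>
            Finset.sum_congr rfl fun g hg => ?_
          have hgpos : (0 : ℝ) < g := by exact_mod_cast (Finset.mem_Icc.mp hg).1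
          push_cast
          rw [Real.mul_rpow (by positivity) (by positivity), Real.mul_rpow hgpos.le (by positivity),
            Real.mul_rpow hgpos.le (by positivity),
            show -(2 * s - 1) = 1 + -s + -s by ring, Real.rpow_add hgpos, Real.rpow_add hgpos,
            Real.rpow_one]
          ring
      _ = (∑ a ∈ Finset.Icc 1 N, (a : ℝ) ^ (-s)) * ((∑ b ∈ Finset.Icc 1 N, (b : ℝ) ^ (-s)) *
            ∑ g ∈ Finset.Icc 1 N, (g : ℝ) ^ (-(2 * s - 1))) := by
          rw [Finset.sum_mul]
          refine Finset.sum_congr rfl fun a _ => ?_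
          rw [Finset.sum_mul_sum, Finset.mul_sum]
          refine Finset.sum_congr rfl fun b _ => ?_
          rw [Finset.mul_sum]
      _ ≤ A * (A * B) := by
          gcongr
          · exact hA N
          · exact hA N
          · exact hB N

/-- For a weight that at most doubles between `p` and `2 * p`, the multiples of `a` carry at most
a proportion `4 / a` of the total weight. -/
theorem mul_sum_mul_le {w : ℕ → ℝ} (hw : ∀ q, 1 ≤ q → 0 ≤ w q)
    (hdoub : ∀ p q, 1 ≤ p → p ≤ q → q ≤ 2 * p → w q ≤ 2 * w p) {a : ℕ} (ha : 1 ≤ a) (G : ℕ) :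
    a * ∑ g ∈ Finset.Icc 1 G, w (g * a) ≤ 4 * ∑ p ∈ Finset.Icc 1 (G * a), w p := by
  induction G with
  | zero => simp
  | succ G ih =>
    rw [Finset.sum_Icc_succ_top (by omega), mul_add]
    -- The top half of the block `(G * a, (G + 1) * a]`: even for `G = 0` its elements `p` satisfy
    -- `(G + 1) * a ≤ 2 * p`, so doubling applies. Doubling and halving each cost a factor `2`.
    set h := (a + 1) / 2
    have hsplit : ∑ p ∈ Finset.Icc 1 (G * a), w p +
        ∑ p ∈ Finset.Ioc ((G + 1) * a - h) ((G + 1) * a), w p ≤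
        ∑ p ∈ Finset.Icc 1 ((G + 1) * a), w p := by
      rw [← Finset.sum_union]
      · refine Finset.sum_le_sum_of_subset_of_nonneg ?_ fun p hp _ => hw p (Finset.mem_Icc.mp hp).1
        intro p hp
        simp only [Finset.mem_union, Finset.mem_Icc, Finset.mem_Ioc] at hp ⊢
        have : (G + 1) * a = G * a + a := by ring
        omega
      · rw [Finset.disjoint_left]
        intro p hp hp'
        simp only [Finset.mem_Icc, Finset.mem_Ioc] at hp hp'
        have : (G + 1) * a = G * a + a := by ring
        omega
    have hlast : (h : ℝ) * w ((G + 1) * a) ≤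
        2 * ∑ p ∈ Finset.Ioc ((G + 1) * a - h) ((G + 1) * a), w p := by
      have hcard : (Finset.Ioc ((G + 1) * a - h) ((G + 1) * a)).card = h := by
        rw [Nat.card_Ioc]
        have : (G + 1) * a = G * a + a := by ring
        omega
      rw [Finset.mul_sum]
      calc (h : ℝ) * w ((G + 1) * a)
          = ∑ _p ∈ Finset.Ioc ((G + 1) * a - h) ((G + 1) * a), w ((G + 1) * a) := by
            rw [Finset.sum_const, hcard, nsmul_eq_mul]
        _ ≤ _ := by
            refine Finset.sum_le_sum fun p hp => ?_
            have : (G + 1) * a = G * a + a := by ring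
            rw [Finset.mem_Ioc] at hp
            exact hdoub p _ (by omega) hp.2 (by omega)
    have hh : (a : ℝ) ≤ 2 * h := by
      have : a ≤ 2 * h := by omega
      exact_mod_cast this
    have hwn : 0 ≤ w ((G + 1) * a) := hw _ (Nat.mul_pos (Nat.succ_pos G) ha)
    nlinarith [mul_le_mul_of_nonneg_right hh hwn]

/-- The quadratic form with coefficients `gcd q r ^ 2 / (q * r)` evaluated at the square root of a
weight that at most doubles between `p` and `2 * p` is controlled by the total weight. -/
theorem exists_sum_gcd_sq_mul_sqrt_le :
    ∃ C : ℝ, 0 ≤ C ∧ ∀ w : ℕ → ℝ, (∀ q, 1 ≤ q → 0 ≤ w q) →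
      (∀ p q, 1 ≤ p → p ≤ q → q ≤ 2 * p → w q ≤ 2 * w p) → ∀ N : ℕ,
      ∑ q ∈ Finset.Icc 1 N, ∑ r ∈ Finset.Icc 1 N,
        (Nat.gcd q r : ℝ) ^ 2 / (q * r) * (√(w q) * √(w r)) ≤
        C * ∑ q ∈ Finset.Icc 1 N, w q := by
  obtain ⟨A, hA0, hA⟩ := exists_sum_rpow_neg_le (s := 3 / 2) (by norm_num)
  refine ⟨4 * (A * A), by positivity, fun w hw hdoub N => ?_⟩
  set W := ∑ q ∈ Finset.Icc 1 N, w q with hW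
  have hW0 : 0 ≤ W := Finset.sum_nonneg fun q hq => hw q (Finset.mem_Icc.mp hq).1
  -- The cutoff keeps `g * a, g * b ≤ N`, a constraint that the triple sum forgets.
  let v : ℕ → ℝ := fun n => if n ≤ N then √(w n) else 0
  have hv0 : ∀ n, 0 ≤ v n := fun n => by
    simp only [v]
    split_ifs <;> positivity
  have hvsum : ∀ a ∈ Finset.Icc 1 N, ∑ g ∈ Finset.Icc 1 N, v (g * a) ^ 2 ≤ 4 * W / a := by
    intro a ha
    have ha1 := (Finset.mem_Icc.mp ha).1
    have haR : (0 : ℝ) < a := by exact_mod_cast ha1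
    have h1 : ∑ g ∈ Finset.Icc 1 N, v (g * a) ^ 2 = ∑ g ∈ Finset.Icc 1 (N / a), w (g * a) := by
      have hsub : Finset.Icc 1 (N / a) ⊆ Finset.Icc 1 N :=
        Finset.Icc_subset_Icc_right (Nat.div_le_self _ _)
      rw [← Finset.sum_subset hsub]
      · refine Finset.sum_congr rfl fun g hg => ?_
        rw [Finset.mem_Icc, Nat.le_div_iff_mul_le ha1] at hg
        simp only [v, if_pos hg.2]
        exact Real.sq_sqrt (hw _ (Nat.mul_pos hg.1 ha1))
      · intro g hg hg'
        rw [Finset.mem_Icc, Nat.le_div_iff_mul_le ha1] at hg'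
        have : ¬ g * a ≤ N := fun h => hg' ⟨(Finset.mem_Icc.mp hg).1, h⟩
        simp [v, this]
    rw [h1, le_div_iff₀ haR, mul_comm]
    refine (mul_sum_mul_le hw hdoub ha1 _).trans ?_
    gcongr
    refine Finset.sum_le_sum_of_subset_of_nonneg
      (Finset.Icc_subset_Icc_right (Nat.div_mul_le_self N a)) fun p hp _ =>
        hw p (Finset.mem_Icc.mp hp).1
  have key := sum_sum_gcd_le N (fun g a b => ((a : ℝ) * b)⁻¹ * (v (g * a) * v (g * b)))
    (fun g a b => mul_nonneg (by positivity) (mul_nonneg (hv0 _) (hv0 _)))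
  refine le_trans (le_of_eq ?_) (key.trans ?_)
  · refine Finset.sum_congr rfl fun q hq => Finset.sum_congr rfl fun r hr => ?_
    rw [Finset.mem_Icc] at hq hr
    have hq0 : (q : ℝ) ≠ 0 := by exact_mod_cast (by omega : q ≠ 0)
    have hr0 : (r : ℝ) ≠ 0 := by exact_mod_cast (by omega : r ≠ 0)
    have hg0 : (Nat.gcd q r : ℝ) ≠ 0 := by
      exact_mod_cast (Nat.gcd_pos_of_pos_left r hq.1).ne'
    rw [Nat.mul_div_cancel' (Nat.gcd_dvd_left q r), Nat.mul_div_cancel' (Nat.gcd_dvd_right q r),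
      Nat.cast_div (Nat.gcd_dvd_left q r) hg0, Nat.cast_div (Nat.gcd_dvd_right q r) hg0]
    simp only [v, if_pos hq.2, if_pos hr.2]
    field_simp
  · calc _ ≤ ∑ a ∈ Finset.Icc 1 N, ∑ b ∈ Finset.Icc 1 N,
          (a : ℝ) ^ (-(3 / 2) : ℝ) * (b : ℝ) ^ (-(3 / 2) : ℝ) * (4 * W) := by
          refine Finset.sum_le_sum fun a ha => Finset.sum_le_sum fun b hb => ?_
          have ha0 : (0 : ℝ) < a := by exact_mod_cast (Finset.mem_Icc.mp ha).1
          have hb0 : (0 : ℝ) < b := by exact_mod_cast (Finset.mem_Icc.mp hb).1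
          have hsa : 0 < √(a : ℝ) := Real.sqrt_pos.mpr ha0
          have hsb : 0 < √(b : ℝ) := Real.sqrt_pos.mpr hb0
          have hpow : ∀ x : ℝ, 0 < x → x ^ (-(3 / 2) : ℝ) = x⁻¹ * (√x)⁻¹ := by
            intro x hx
            rw [show (-(3 / 2) : ℝ) = -1 + -(1 / 2) by norm_num, Real.rpow_add hx,
              Real.rpow_neg_one, Real.rpow_neg hx.le, Real.sqrt_eq_rpow]
          rw [← Finset.mul_sum, hpow _ ha0, hpow _ hb0]
          have hyoung : ∑ g ∈ Finset.Icc 1 N, v (g * a) * v (g * b) ≤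
              (√(a : ℝ) * √(b : ℝ))⁻¹ * (4 * W) := by
            -- AM-GM weighted by `√a / √b` balances the masses `4 * W / a` and `4 * W / b` of the
            -- two sets of multiples. The gain `(a * b) ^ (-1/2)` makes the sum over `a, b`
            -- converge.
            have hterm : ∀ g, v (g * a) * v (g * b) ≤ (√(a : ℝ) / √(b : ℝ)) / 2 * v (g * a) ^ 2 +
                (√(b : ℝ) / √(a : ℝ)) / 2 * v (g * b) ^ 2 := by
              intro g
              have := sq_nonneg (√(a : ℝ) * v (g * a) - √(b : ℝ) * v (g * b))
              rw [← sub_nonneg]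
              have h2 : (√(a : ℝ) / √(b : ℝ)) / 2 * v (g * a) ^ 2 +
                (√(b : ℝ) / √(a : ℝ)) / 2 * v (g * b) ^ 2 - v (g * a) * v (g * b) =
                (√(a : ℝ) * v (g * a) - √(b : ℝ) * v (g * b)) ^ 2 /
                  (2 * (√(a : ℝ) * √(b : ℝ))) := by
                field_simp
                ring
              rw [h2]
              positivity
            calc _ ≤ ∑ g ∈ Finset.Icc 1 N, ((√(a : ℝ) / √(b : ℝ)) / 2 * v (g * a) ^ 2 +
                (√(b : ℝ) / √(a : ℝ)) / 2 * v (g * b) ^ 2) := Finset.sum_le_sum fun g _ => hterm g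
              _ = (√(a : ℝ) / √(b : ℝ)) / 2 * ∑ g ∈ Finset.Icc 1 N, v (g * a) ^ 2 +
                (√(b : ℝ) / √(a : ℝ)) / 2 * ∑ g ∈ Finset.Icc 1 N, v (g * b) ^ 2 := by
                  rw [Finset.sum_add_distrib, Finset.mul_sum, Finset.mul_sum]
              _ ≤ (√(a : ℝ) / √(b : ℝ)) / 2 * (4 * W / a) +
                (√(b : ℝ) / √(a : ℝ)) / 2 * (4 * W / b) := by
                  gcongr
                  · exact hvsum a ha
                  · exact hvsum b hb
              _ = _ := by
                  have h1 : (a : ℝ) = √(a : ℝ) ^ 2 := (Real.sq_sqrt ha0.le).symm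
                  have h2 : (b : ℝ) = √(b : ℝ) ^ 2 := (Real.sq_sqrt hb0.le).symm
                  have h3 : 4 * W / (a : ℝ) = 4 * W / √(a : ℝ) ^ 2 := by rw [← h1]
                  have h4 : 4 * W / (b : ℝ) = 4 * W / √(b : ℝ) ^ 2 := by rw [← h2]
                  rw [h3, h4]
                  field_simp
                  ring
          calc _ ≤ ((a : ℝ) * b)⁻¹ * ((√(a : ℝ) * √(b : ℝ))⁻¹ * (4 * W)) := by gcongr
            _ = _ := by
                rw [mul_inv, mul_inv]
                ring
      _ = (∑ a ∈ Finset.Icc 1 N, (a : ℝ) ^ (-(3 / 2) : ℝ)) *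
            (∑ b ∈ Finset.Icc 1 N, (b : ℝ) ^ (-(3 / 2) : ℝ)) * (4 * W) := by
          rw [Finset.sum_mul_sum, Finset.sum_mul]
          refine Finset.sum_congr rfl fun a _ => ?_
          rw [Finset.sum_mul]
      _ ≤ A * A * (4 * W) := by
          gcongr
          · exact hA N
          · exact hA N
      _ = _ := by ring

/-! ### A geometric sum and the second-moment criterion. -/

/-- A two-sided geometric sum, bounded by telescoping `u / (1 + u)`. -/
theorem sum_min_mul_two_pow_le {c : ℝ} (hc : 0 < c) (s : Finset ℕ) :
    ∑ i ∈ s, min (c * 2 ^ i) (c * 2 ^ i)⁻¹ ≤ 6 := by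
  obtain ⟨M, hM⟩ : ∃ M, s ⊆ Finset.range M :=
    ⟨s.sup id + 1, fun i hi =>
      Finset.mem_range.mpr (Nat.lt_succ_of_le (Finset.le_sup (f := id) hi))⟩
  let φ : ℕ → ℝ := fun i => c * 2 ^ i / (1 + c * 2 ^ i)
  have hterm : ∀ i, min (c * 2 ^ i) (c * 2 ^ i)⁻¹ ≤ 6 * (φ (i + 1) - φ i) := by
    intro i
    have hu : 0 < c * 2 ^ i := by positivity
    simp only [φ, pow_succ]
    rw [← mul_assoc]
    set u := c * 2 ^ i
    have h : u * 2 / (1 + u * 2) - u / (1 + u) = u / ((1 + u * 2) * (1 + u)) := by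
      field_simp
      ring
    rw [h, ← mul_div_assoc, le_div_iff₀ (by positivity)]
    rcases le_total u 1 with h1 | h1
    · calc _ ≤ u * ((1 + u * 2) * (1 + u)) := by
            gcongr
            exact min_le_left _ _
        _ ≤ u * ((1 + 1 * 2) * (1 + 1)) := by gcongr
        _ = 6 * u := by ring
    · calc _ ≤ u⁻¹ * ((1 + u * 2) * (1 + u)) := by
            gcongr
            exact min_le_right _ _
        _ ≤ u⁻¹ * ((u + u * 2) * (u + u)) := by gcongr
        _ = 6 * u := by
            field_simp
            ring
  calc _ ≤ ∑ i ∈ Finset.range M, min (c * 2 ^ i) (c * 2 ^ i)⁻¹ :=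
        Finset.sum_le_sum_of_subset_of_nonneg hM fun i _ _ => by positivity
    _ ≤ ∑ i ∈ Finset.range M, 6 * (φ (i + 1) - φ i) := Finset.sum_le_sum fun i _ => hterm i
    _ = 6 * (φ M - φ 0) := by rw [← Finset.mul_sum, Finset.sum_range_sub]
    _ ≤ 6 := by
        have h1 : φ M ≤ 1 := by
          simp only [φ]
          rw [div_le_one (by positivity)]
          linarith
        have h2 : 0 ≤ φ 0 := by positivity
        linarith

/-- A second-moment criterion: if the pair correlations of the events `S α` exceed the square of
the expected number of events by at most a linear term, then almost surely infinitely many of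
them occur. -/
theorem ae_infinite_of_sum_measureReal_inter_le {Ω ι : Type*} [MeasurableSpace Ω]
    (P : Measure Ω) [IsProbabilityMeasure P] (S : ι → Set Ω) (hS : ∀ α, MeasurableSet (S α))
    (F : ℕ → Finset ι) (C : ℝ)
    (hE : Tendsto (fun N => ∑ α ∈ F N, P.real (S α)) atTop atTop)
    (hcorr : ∀ N, ∑ α ∈ F N, ∑ β ∈ F N, P.real (S α ∩ S β) ≤
      (∑ α ∈ F N, P.real (S α)) ^ 2 + C * (∑ α ∈ F N, P.real (S α)) + C) :
    ∀ᵐ ω ∂P, {α | ω ∈ S α}.Infinite := by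
  classical
  set E : ℕ → ℝ := fun N => ∑ α ∈ F N, P.real (S α)
  let f : ℕ → Ω → ℝ := fun N ω => ∑ α ∈ F N, (S α).indicator (fun _ => (1 : ℝ)) ω
  have hmeas : ∀ N, Measurable (f N) := fun N =>
    Finset.measurable_fun_sum _ fun α _ => measurable_const.indicator (hS α)
  have hnn : ∀ N ω, 0 ≤ f N ω := fun N ω =>
    Finset.sum_nonneg fun α _ => Set.indicator_nonneg (fun _ _ => zero_le_one) ω
  have hbdd : ∀ N ω, ‖f N ω‖ ≤ (F N).card := by
    intro N ω
    rw [Real.norm_of_nonneg (hnn N ω)]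
    calc f N ω ≤ ∑ α ∈ F N, (1 : ℝ) := Finset.sum_le_sum fun α _ =>
          Set.indicator_le_self' (fun _ _ => zero_le_one) ω
      _ = (F N).card := by simp
  have hLp : ∀ N, MemLp (f N) 2 P := fun N =>
    MemLp.of_bound (hmeas N).aestronglyMeasurable _ (Eventually.of_forall (hbdd N))
  have hint : ∀ A : Set Ω, MeasurableSet A → Integrable (A.indicator fun _ => (1 : ℝ)) P :=
    fun A hA => (integrable_const _).indicator hA
  have hmean : ∀ N, P[f N] = E N := by
    intro N
    simp only [f]
    rw [integral_finsetSum _ fun α _ => hint _ (hS α)]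
    refine Finset.sum_congr rfl fun α _ => ?_
    rw [integral_indicator_const _ (hS α)]
    simp
  have hsq : ∀ N, P[f N ^ 2] = ∑ α ∈ F N, ∑ β ∈ F N, P.real (S α ∩ S β) := by
    intro N
    have : ∀ ω, (f N ^ 2) ω = ∑ α ∈ F N, ∑ β ∈ F N,
        (S α ∩ S β).indicator (fun _ => (1 : ℝ)) ω := by
      intro ω
      simp only [Pi.pow_apply, f, sq, Finset.sum_mul_sum]
      refine Finset.sum_congr rfl fun α _ => Finset.sum_congr rfl fun β _ => ?_
      by_cases h1 : ω ∈ S α <;> by_cases h2 : ω ∈ S β <;> simp [h1, h2]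
    simp only [this]
    rw [integral_finsetSum _ fun α _ => integrable_finsetSum _ fun β _ =>
      hint _ ((hS α).inter (hS β))]
    refine Finset.sum_congr rfl fun α _ => ?_
    rw [integral_finsetSum _ fun β _ => hint _ ((hS α).inter (hS β))]
    refine Finset.sum_congr rfl fun β _ => ?_
    rw [integral_indicator_const _ ((hS α).inter (hS β))]
    simp
  have hvar : ∀ N, variance (f N) P ≤ C * E N + C := by
    intro N
    rw [variance_eq_sub (hLp N), hsq, hmean]
    linarith [hcorr N]
  -- Chebyshev: a count that stays at most `M` deviates from its mean by `E N - M`, while the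
  -- variance is only linear in `E N`.
  have hzero : ∀ M : ℕ, P {ω | ∀ N, f N ω ≤ M} = 0 := by
    intro M
    have hlim : Tendsto (fun N => ENNReal.ofReal ((C * E N + C) / (E N - M) ^ 2)) atTop (𝓝 0) := by
      rw [← ENNReal.ofReal_zero]
      refine (ENNReal.continuous_ofReal.tendsto _).comp ?_
      have h1 : Tendsto (fun t : ℝ => (C * t + C) / (t - M) ^ 2) atTop (𝓝 0) := by
        have h2 : Tendsto (fun t : ℝ => C / (t - M) + (C * M + C) / (t - M) ^ 2) atTop
            (𝓝 (0 + 0)) := by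
          have h3 : Tendsto (fun t : ℝ => t - M) atTop atTop :=
            tendsto_atTop_add_const_right _ _ tendsto_id
          exact (h3.const_div_atTop C).add
            (((tendsto_pow_atTop two_ne_zero).comp h3).const_div_atTop _)
        rw [add_zero] at h2
        refine h2.congr' ?_
        filter_upwards [eventually_gt_atTop (M : ℝ)] with t ht
        have : t - M ≠ 0 := by linarith
        field_simp
        ring
      exact h1.comp hE
    refine le_antisymm (ge_of_tendsto hlim ?_) (zero_le)
    filter_upwards [hE.eventually (eventually_gt_atTop (M : ℝ))] with N hN
    have hpos : 0 < E N - M := by linarith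
    calc P {ω | ∀ N, f N ω ≤ M} ≤ P {ω | E N - M ≤ |f N ω - P[f N]|} := by
          refine measure_mono fun ω hω => ?_
          have h1 : f N ω ≤ M := hω N
          simp only [Set.mem_ofPred_eq, hmean]
          rw [abs_sub_comm]
          exact le_trans (by linarith) (le_abs_self _)
      _ ≤ ENNReal.ofReal (variance (f N) P / (E N - M) ^ 2) :=
          meas_ge_le_variance_div_sq (hLp N) hpos
      _ ≤ _ := ENNReal.ofReal_le_ofReal (by gcongr; exact hvar N)
  have hall : ∀ᵐ ω ∂P, ∀ M : ℕ, ¬ ∀ N, f N ω ≤ M := by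
    rw [ae_all_iff]
    intro M
    rw [ae_iff]
    simpa using hzero M
  filter_upwards [hall] with ω hω hfin
  refine hω hfin.toFinset.card fun N => ?_
  have : f N ω = (((F N).filter fun α => ω ∈ S α).card : ℝ) := by
    simp [f, Set.indicator_apply]
  rw [this]
  exact_mod_cast Finset.card_le_card fun α hα => by
    simpa using (Finset.mem_filter.mp hα).2

/-! ### Dyadic scales. -/

/-- The dyadic scales attached to `q`: those `i` for which `2 ^ i` lies roughly between
`q ^ (1 / 4)` and `q ^ (1 / 2)`. -/
def middleScales (q : ℕ) : Finset ℕ :=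
  Finset.Ioc (Nat.log 2 q / 4) (2 * (Nat.log 2 q / 4) + 1)

/-- The number of middle scales of `q`. -/
def scaleCount (q : ℕ) : ℕ := Nat.log 2 q / 4 + 1

theorem card_middleScales (q : ℕ) : (middleScales q).card = scaleCount q := by
  rw [middleScales, scaleCount, Nat.card_Ioc]
  omega

theorem scaleCount_mono : Monotone scaleCount := fun p q hpq => by
  have := Nat.log_mono_right (b := 2) hpq
  unfold scaleCount
  omega

theorem scaleCount_le_two_mul {p q : ℕ} (hp : 1 ≤ p) (hq : q ≤ 2 * p) :
    scaleCount q ≤ 2 * scaleCount p := by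
  have h1 := Nat.log_mono_right (b := 2) hq
  rw [mul_comm, Nat.log_mul_base one_lt_two (by omega)] at h1
  unfold scaleCount
  omega

/-- The strict lower end of the interval of scales absorbs the rounding in `Nat.log 2 q / 4`. -/
theorem le_two_pow_middleScales {q i : ℕ} (hi : i ∈ middleScales q) : q ≤ (2 ^ i) ^ 4 := by
  rw [middleScales, Finset.mem_Ioc] at hi
  rw [← pow_mul]
  calc q ≤ 2 ^ (Nat.log 2 q + 1) := (Nat.lt_pow_succ_log_self one_lt_two q).le
    _ ≤ 2 ^ (i * 4) := Nat.pow_le_pow_right two_pos (by omega)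

theorem two_pow_sq_middleScales_le {q i : ℕ} (hq : 1 ≤ q) (hi : i ∈ middleScales q) :
    (2 ^ i) ^ 2 ≤ 4 * q := by
  rw [middleScales, Finset.mem_Ioc] at hi
  rw [← pow_mul]
  calc 2 ^ (i * 2) ≤ 2 ^ (2 + Nat.log 2 q) := Nat.pow_le_pow_right two_pos (by omega)
    _ = 4 * 2 ^ Nat.log 2 q := by rw [pow_add]; norm_num
    _ ≤ 4 * q := Nat.mul_le_mul_left _ (Nat.pow_log_le_self 2 (by omega))

theorem one_le_middleScales {q i : ℕ} (hi : i ∈ middleScales q) : 1 ≤ i := by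
  rw [middleScales, Finset.mem_Ioc] at hi
  omega

theorem log_le_scaleCount (q : ℕ) (hq : 1 ≤ q) : Real.log q ≤ 4 * scaleCount q := by
  have h1 : q ≤ 2 ^ (4 * scaleCount q) :=
    (Nat.lt_pow_succ_log_self one_lt_two q).le.trans
      (Nat.pow_le_pow_right two_pos (by unfold scaleCount; omega))
  have h2 : (q : ℝ) ≤ 2 ^ (4 * scaleCount q) := by exact_mod_cast h1
  have h3 := Real.log_le_log (by exact_mod_cast hq) h2
  rw [Real.log_pow] at h3
  push_cast at h3
  have := Real.log_two_lt_d9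
  have h4 : (0 : ℝ) ≤ 4 * scaleCount q := by positivity
  nlinarith

/-- The exponent `1 / 16` is small enough that counting scales weakens `(q * r) ^ (-18/16)` only to
the still summable `(q * r) ^ (-17/16)`. -/
theorem scaleCount_le_rpow (q : ℕ) (hq : 1 ≤ q) :
    (scaleCount q : ℝ) ≤ 9 * (q : ℝ) ^ (1 / 16 : ℝ) := by
  have hqR : (1 : ℝ) ≤ q := by exact_mod_cast hq
  have h1 : (2 : ℝ) ^ Nat.log 2 q ≤ q := by
    exact_mod_cast Nat.pow_log_le_self 2 (by omega)
  have h2 := Real.log_le_log (by positivity) h1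
  rw [Real.log_pow] at h2
  have h3 := Real.log_le_rpow_div (by positivity : (0 : ℝ) ≤ q) (by norm_num : (0 : ℝ) < 1 / 16)
  have h4 : (1 : ℝ) ≤ (q : ℝ) ^ (1 / 16 : ℝ) := Real.one_le_rpow hqR (by norm_num)
  have h5 : (4 * scaleCount q : ℝ) ≤ Nat.log 2 q + 4 := by
    have : 4 * scaleCount q ≤ Nat.log 2 q + 4 := by unfold scaleCount; omega
    exact_mod_cast this
  have := Real.log_two_gt_d9
  have h6 : (0 : ℝ) ≤ Nat.log 2 q := by positivity
  nlinarith

theorem min_le_of_mul_le_pow_two {x y z : ℝ} (hz : 0 ≤ z) (h : x * y ≤ z ^ 2) : min x y ≤ z := by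
  by_contra! hlt
  rw [lt_min_iff] at hlt
  nlinarith [mul_lt_mul'' hlt.1 hlt.2 hz hz]

/-! ### Error terms for a fixed pair, summed over scales. -/

section Pair

variable {ψ : ℕ → ℝ} {q r : ℕ}

theorem sum_sum_le_card_mul (hq : 1 ≤ q) (hr : 1 ≤ r) {f : ℕ → ℕ → ℝ} {c : ℝ} (hc : 0 ≤ c)
    (hf : ∀ i ∈ middleScales q, ∀ j ∈ middleScales r,
      f i j ≤ c * ((q : ℝ) * r) ^ (-(18 / 16) : ℝ)) :
    ∑ i ∈ middleScales q, ∑ j ∈ middleScales r, f i j ≤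
      81 * c * ((q : ℝ) * r) ^ (-(17 / 16) : ℝ) := by
  have hqR : (0 : ℝ) < q := by exact_mod_cast hq
  have hrR : (0 : ℝ) < r := by exact_mod_cast hr
  calc _ ≤ ∑ i ∈ middleScales q, ∑ j ∈ middleScales r, c * ((q : ℝ) * r) ^ (-(18 / 16) : ℝ) :=
        Finset.sum_le_sum fun i hi => Finset.sum_le_sum fun j hj => hf i hi j hj
    _ = scaleCount q * (scaleCount r * (c * ((q : ℝ) * r) ^ (-(18 / 16) : ℝ))) := by
        simp [card_middleScales]
    _ ≤ (9 * (q : ℝ) ^ (1 / 16 : ℝ)) * ((9 * (r : ℝ) ^ (1 / 16 : ℝ)) *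
          (c * ((q : ℝ) * r) ^ (-(18 / 16) : ℝ))) := by
        gcongr
        · exact scaleCount_le_rpow q hq
        · exact scaleCount_le_rpow r hr
    _ = _ := by
        rw [show (-(17 / 16) : ℝ) = 1 / 16 + -(18 / 16) by norm_num,
          Real.rpow_add (by positivity), Real.mul_rpow (z := 1 / 16) hqR.le hrR.le]
        ring

/-- In terms of `z = x ^ (1 / 8)` the estimates below involve only integer powers. -/
theorem rpow_neg_eighteen_div (x : ℝ) (hx : 0 < x) :
    (x ^ (1 / 8 : ℝ)) ^ 8 = x ∧ x ^ (-(18 / 16) : ℝ) = ((x ^ (1 / 8 : ℝ)) ^ 9)⁻¹ := by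
  constructor
  · rw [← Real.rpow_natCast, ← Real.rpow_mul hx.le]
    norm_num
  · rw [← Real.rpow_natCast, ← Real.rpow_mul hx.le, ← Real.rpow_neg hx.le]
    norm_num

/-- Main term in the first coordinate against the divisor term in the second. -/
theorem sum_sum_mul_min_inv_le (hψ0 : ∀ q, 1 ≤ q → 0 ≤ ψ q)
    (hψ1 : ∀ q, 1 ≤ q → ψ q ≤ (4 * q : ℝ)⁻¹) (hq : 1 ≤ q) (hr : 1 ≤ r) :
    ∑ i ∈ middleScales q, ∑ j ∈ middleScales r,
      (ψ q * 2 ^ i) * (ψ r * 2 ^ j) * min (((2 : ℝ) ^ i)⁻¹ / q) (((2 : ℝ) ^ j)⁻¹ / r) ≤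
    81 * ((q : ℝ) * r) ^ (-(17 / 16) : ℝ) := by
  have hqR : (0 : ℝ) < q := by exact_mod_cast hq
  have hrR : (0 : ℝ) < r := by exact_mod_cast hr
  refine (sum_sum_le_card_mul hq hr zero_le_one fun i hi j hj => ?_).trans (by rw [mul_one])
  obtain ⟨hz, hz'⟩ := rpow_neg_eighteen_div ((q : ℝ) * r) (by positivity)
  rw [hz', one_mul]
  set z := ((q : ℝ) * r) ^ (1 / 8 : ℝ)
  have hzpos : 0 < z := by positivity
  have hz1 : 1 ≤ z := Real.one_le_rpow (by
    have : 1 ≤ q * r := Nat.mul_pos hq hr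
    exact_mod_cast this) (by norm_num)
  have hP : ((2 : ℝ) ^ i) ^ 2 ≤ 4 * q := by exact_mod_cast two_pow_sq_middleScales_le hq hi
  have hR : ((2 : ℝ) ^ j) ^ 2 ≤ 4 * r := by exact_mod_cast two_pow_sq_middleScales_le hr hj
  set x : ℝ := 2 ^ i
  set y : ℝ := 2 ^ j
  have hx : 0 < x := by positivity
  have hy : 0 < y := by positivity
  have hxy : x * y ≤ 4 * z ^ 4 := by
    refine (pow_le_pow_iff_left₀ (by positivity) (by positivity) two_ne_zero).mp ?_
    calc (x * y) ^ 2 = x ^ 2 * y ^ 2 := by ring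
      _ ≤ (4 * q : ℝ) * (4 * r : ℝ) := by gcongr
      _ = 16 * (q * r : ℝ) := by ring
      _ = (4 * z ^ 4) ^ 2 := by rw [← hz]; ring
  -- The minimum is at most the geometric mean. The upper end of the scales gives `x * y ≤ 4 * z ^
  -- 4`, leaving a total of order `z ^ (-10)`, one power of `z` to spare.
  have hm : x * y * min (x⁻¹ / q) (y⁻¹ / r) ≤ 2 * (z ^ 2)⁻¹ := by
    rw [mul_min_of_nonneg _ _ (by positivity)]
    refine min_le_of_mul_le_pow_two (by positivity) ?_
    calc x * y * (x⁻¹ / q) * (x * y * (y⁻¹ / r)) = x * y / (q * r) := by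
          field_simp
      _ ≤ 4 * z ^ 4 / (q * r) := by gcongr
      _ = (2 * (z ^ 2)⁻¹) ^ 2 := by
          rw [← hz]
          field_simp
          norm_num
  calc _ = ψ q * ψ r * (x * y * min (x⁻¹ / q) (y⁻¹ / r)) := by ring
    _ ≤ (4 * q : ℝ)⁻¹ * (4 * r : ℝ)⁻¹ * (2 * (z ^ 2)⁻¹) := by
        gcongr
        · exact hψ0 r hr
        · exact hψ1 q hq
        · exact hψ1 r hr
    _ = 1 / 8 * (z ^ 10)⁻¹ := by
        rw [← mul_inv, show (4 * q * (4 * r) : ℝ) = 16 * (q * r) by ring, ← hz]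
        field_simp
        norm_num
    _ ≤ 1 * (z ^ 9)⁻¹ := by
        gcongr
        · norm_num
        · norm_num
    _ = (z ^ 9)⁻¹ := one_mul _

/-- Divisor term in the first coordinate against the main term in the second. -/
theorem sum_sum_inv_mul_min_le (hψ0 : ∀ q, 1 ≤ q → 0 ≤ ψ q)
    (hψ1 : ∀ q, 1 ≤ q → ψ q ≤ (4 * q : ℝ)⁻¹) (hq : 1 ≤ q) (hr : 1 ≤ r) :
    ∑ i ∈ middleScales q, ∑ j ∈ middleScales r,
      ((2 : ℝ) ^ i)⁻¹ * ((2 : ℝ) ^ j)⁻¹ * min (ψ q * 2 ^ i / q) (ψ r * 2 ^ j / r) ≤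
    81 * ((q : ℝ) * r) ^ (-(17 / 16) : ℝ) := by
  have hqR : (0 : ℝ) < q := by exact_mod_cast hq
  have hrR : (0 : ℝ) < r := by exact_mod_cast hr
  refine (sum_sum_le_card_mul hq hr zero_le_one fun i hi j hj => ?_).trans (by rw [mul_one])
  obtain ⟨hz, hz'⟩ := rpow_neg_eighteen_div ((q : ℝ) * r) (by positivity)
  rw [hz', one_mul]
  set z := ((q : ℝ) * r) ^ (1 / 8 : ℝ)
  have hzpos : 0 < z := by positivity
  have hP : (q : ℝ) ≤ ((2 : ℝ) ^ i) ^ 4 := by exact_mod_cast le_two_pow_middleScales hi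
  have hR : (r : ℝ) ≤ ((2 : ℝ) ^ j) ^ 4 := by exact_mod_cast le_two_pow_middleScales hj
  set x : ℝ := 2 ^ i
  set y : ℝ := 2 ^ j
  have hx : 0 < x := by positivity
  have hy : 0 < y := by positivity
  -- The lower end of the scales gives `x * y ≥ (q * r) ^ (1/4)`; its square root is the extra `1 /
  -- 8` in the exponent `18 / 16`.
  have hxy : z ^ 2 ≤ x * y := by
    refine (pow_le_pow_iff_left₀ (by positivity) (by positivity) four_ne_zero).mp ?_
    calc (z ^ 2) ^ 4 = q * r := by rw [← hz]; ring
      _ ≤ x ^ 4 * y ^ 4 := by gcongr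
      _ = (x * y) ^ 4 := by ring
  have hψq := hψ0 q hq
  have hψr := hψ0 r hr
  rw [mul_min_of_nonneg _ _ (by positivity)]
  refine min_le_of_mul_le_pow_two (by positivity) ?_
  calc x⁻¹ * y⁻¹ * (ψ q * x / q) * (x⁻¹ * y⁻¹ * (ψ r * y / r))
      = ψ q * ψ r * (q * r : ℝ)⁻¹ * (x * y)⁻¹ := by field_simp
    _ ≤ (4 * q : ℝ)⁻¹ * (4 * r : ℝ)⁻¹ * (q * r : ℝ)⁻¹ * (z ^ 2)⁻¹ := by
        gcongr
        · exact hψ1 q hq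
        · exact hψ1 r hr
    _ = 1 / 16 * ((z ^ 9)⁻¹) ^ 2 := by
        rw [← mul_inv, show (4 * q * (4 * r) : ℝ) = 16 * (q * r) by ring, ← hz]
        field_simp
    _ ≤ 1 * ((z ^ 9)⁻¹) ^ 2 := by
        gcongr
        norm_num
    _ = _ := one_mul _

/-- Divisor terms in both coordinates. -/
theorem sum_sum_min_mul_min_le (hψ0 : ∀ q, 1 ≤ q → 0 < ψ q) (hq : 1 ≤ q) (hr : 1 ≤ r) :
    ∑ i ∈ middleScales q, ∑ j ∈ middleScales r,
      min (ψ q * 2 ^ i / q) (ψ r * 2 ^ j / r) *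
        min (((2 : ℝ) ^ i)⁻¹ / q) (((2 : ℝ) ^ j)⁻¹ / r) ≤
    6 * ((q * r : ℝ)⁻¹ * (√(ψ q * scaleCount q) * √(ψ r * scaleCount r))) := by
  have hqR : (0 : ℝ) < q := by exact_mod_cast hq
  have hrR : (0 : ℝ) < r := by exact_mod_cast hr
  set h := √(ψ q)
  set k := √(ψ r)
  have hh : h ^ 2 = ψ q := Real.sq_sqrt (hψ0 q hq).le
  have hk : k ^ 2 = ψ r := Real.sq_sqrt (hψ0 r hr).le
  have hhpos : 0 < h := Real.sqrt_pos.mpr (hψ0 q hq)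
  have hkpos : 0 < k := Real.sqrt_pos.mpr (hψ0 r hr)
  -- Bounding by the cross products `A * E` and `B * D` produces `s * u` and `s / u` with `u = (h /
  -- k) * 2 ^ (i - j)`: a geometric sum in either index once the other is fixed.
  have hpair : ∀ {A B D E s : ℝ}, 0 ≤ A → 0 ≤ B → 0 ≤ D → 0 ≤ E → 0 < s → ∀ u : ℝ,
      A * E = s * u → B * D = s * u⁻¹ → min A B * min D E ≤ s * min u u⁻¹ := by
    intro A B D E s hA hB hD hE hs u h1 h2
    rw [mul_min_of_nonneg _ _ hs.le, ← h1, ← h2]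
    exact le_min (mul_le_mul (min_le_left _ _) (min_le_right _ _) (le_min hD hE) hA)
      (mul_le_mul (min_le_right _ _) (min_le_left _ _) (le_min hD hE) hB)
  rw [← hh, ← hk]
  set s := (q * r : ℝ)⁻¹ * (h * k)
  have hs : 0 < s := by positivity
  have hterm : ∀ i j : ℕ, min (h ^ 2 * 2 ^ i / q) (k ^ 2 * 2 ^ j / r) *
        min (((2 : ℝ) ^ i)⁻¹ / q) (((2 : ℝ) ^ j)⁻¹ / r) ≤
        s * min ((h / (k * 2 ^ j)) * 2 ^ i) ((h / (k * 2 ^ j)) * 2 ^ i)⁻¹ ∧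
      min (h ^ 2 * 2 ^ i / q) (k ^ 2 * 2 ^ j / r) *
        min (((2 : ℝ) ^ i)⁻¹ / q) (((2 : ℝ) ^ j)⁻¹ / r) ≤
        s * min ((k / (h * 2 ^ i)) * 2 ^ j) ((k / (h * 2 ^ i)) * 2 ^ j)⁻¹ := by
    intro i j
    constructor
    · refine hpair (by positivity) (by positivity) (by positivity) (by positivity) hs _ ?_ ?_
      · simp only [s]
        field_simp
      · simp only [s]
        field_simp
    · rw [min_comm (k / (h * 2 ^ i) * 2 ^ j)]
      rw [show k / (h * 2 ^ i) * 2 ^ j = ((k / (h * 2 ^ i) * 2 ^ j)⁻¹)⁻¹ by rw [inv_inv],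
        inv_inv (k / (h * 2 ^ i) * 2 ^ j)⁻¹]
      refine hpair (by positivity) (by positivity) (by positivity) (by positivity) hs _ ?_ ?_
      · simp only [s]
        field_simp
      · simp only [s]
        field_simp
  set T := ∑ i ∈ middleScales q, ∑ j ∈ middleScales r,
      min (h ^ 2 * 2 ^ i / q) (k ^ 2 * 2 ^ j / r) *
        min (((2 : ℝ) ^ i)⁻¹ / q) (((2 : ℝ) ^ j)⁻¹ / r) with hT
  have h1 : T ≤ scaleCount q * (s * 6) := by
    rw [hT, ← card_middleScales, ← nsmul_eq_mul]
    refine Finset.sum_le_card_nsmul _ _ _ fun i _ => ?_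
    calc _ ≤ ∑ j ∈ middleScales r,
          s * min ((k / (h * 2 ^ i)) * 2 ^ j) ((k / (h * 2 ^ i)) * 2 ^ j)⁻¹ :=
          Finset.sum_le_sum fun j _ => (hterm i j).2
      _ ≤ s * 6 := by
          rw [← Finset.mul_sum]
          gcongr
          exact sum_min_mul_two_pow_le (by positivity) _
  have h2 : T ≤ scaleCount r * (s * 6) := by
    rw [hT, Finset.sum_comm, ← card_middleScales, ← nsmul_eq_mul]
    refine Finset.sum_le_card_nsmul _ _ _ fun j _ => ?_
    calc _ ≤ ∑ i ∈ middleScales q,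
          s * min ((h / (k * 2 ^ j)) * 2 ^ i) ((h / (k * 2 ^ j)) * 2 ^ i)⁻¹ :=
          Finset.sum_le_sum fun i _ => (hterm i j).1
      _ ≤ s * 6 := by
          rw [← Finset.mul_sum]
          gcongr
          exact sum_min_mul_two_pow_le (by positivity) _
  have h3 : T ≤ min (scaleCount q : ℝ) (scaleCount r) * (s * 6) := by
    rw [min_mul_of_nonneg _ _ (by positivity)]
    exact le_min h1 h2
  have h4 : min (scaleCount q : ℝ) (scaleCount r) ≤ √(scaleCount q) * √(scaleCount r) := by
    refine min_le_of_mul_le_pow_two (by positivity) ?_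
    rw [mul_pow, Real.sq_sqrt (by positivity), Real.sq_sqrt (by positivity)]
  calc T ≤ √(scaleCount q) * √(scaleCount r) * (s * 6) := h3.trans (by gcongr)
    _ = _ := by
      rw [Real.sqrt_mul' _ (by positivity), Real.sqrt_mul' _ (by positivity),
        Real.sqrt_sq hhpos.le, Real.sqrt_sq hkpos.le]
      simp only [s]
      ring

end Pair

/-! ### Truncation of `ψ`. -/

/-- Truncating a monotone `ψ` at `1 / (4 * q)` keeps the series `∑ ψ q * log q` divergent. -/
theorem tendsto_sum_min_mul_scaleCount {ψ : ℕ → ℝ} (hψ : ∀ q, 1 ≤ q → 0 < ψ q)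
    (hmono : AntitoneOn ψ (Set.Ici 1))
    (hdiv : Tendsto (fun N : ℕ => ∑ q ∈ Finset.Icc 1 N, ψ q * Real.log q) atTop atTop) :
    Tendsto (fun N : ℕ => ∑ q ∈ Finset.Icc 1 N, min (ψ q) (4 * q : ℝ)⁻¹ * scaleCount q)
      atTop atTop := by
  have hnn : ∀ q, 1 ≤ q → 0 ≤ min (ψ q) (4 * q : ℝ)⁻¹ * scaleCount q := fun q hq =>
    mul_nonneg (le_min (hψ q hq).le (by positivity)) (Nat.cast_nonneg _)
  -- Either `ψ` reaches `1 / (4 * q)` at arbitrarily large `q`, and by monotonicity the block `(q /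
  -- 2, q]` alone contributes at least `K / 8`; or the truncation is eventually inactive.
  by_cases hbig : ∀ Q : ℕ, ∃ q, Q ≤ q ∧ (4 * q : ℝ)⁻¹ ≤ ψ q
  · refine tendsto_atTop_atTop_of_monotone ?_ fun b => ?_
    · intro M N hMN
      exact Finset.sum_le_sum_of_subset_of_nonneg (Finset.Icc_subset_Icc_right hMN)
        fun q hq _ => hnn q (Finset.mem_Icc.mp hq).1
    · obtain ⟨K, hK⟩ := exists_nat_ge (8 * b)
      obtain ⟨q, hq, hψq⟩ := hbig (2 * 2 ^ (4 * K))
      have hpow : 1 ≤ 2 ^ (4 * K) := Nat.one_le_two_pow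
      have hq1 : 1 ≤ q := by omega
      have hqR : (0 : ℝ) < q := by exact_mod_cast hq1
      have hcount : K ≤ scaleCount (2 ^ (4 * K)) := by
        rw [scaleCount, Nat.log_pow one_lt_two]
        omega
      refine ⟨q, ?_⟩
      calc b ≤ q / 2 * ((4 * q : ℝ)⁻¹ * K) := by
            field_simp
            linarith
        _ ≤ (q - q / 2 : ℕ) * ((4 * q : ℝ)⁻¹ * K) := by
            gcongr
            have : q ≤ 2 * (q - q / 2) := by omega
            have : (q : ℝ) ≤ 2 * (q - q / 2 : ℕ) := by exact_mod_cast this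
            linarith
        _ = ∑ _p ∈ Finset.Ioc (q / 2) q, (4 * q : ℝ)⁻¹ * K := by
            rw [Finset.sum_const, Nat.card_Ioc, nsmul_eq_mul]
        _ ≤ ∑ p ∈ Finset.Ioc (q / 2) q, min (ψ p) (4 * p : ℝ)⁻¹ * scaleCount p := by
            refine Finset.sum_le_sum fun p hp => ?_
            rw [Finset.mem_Ioc] at hp
            have hp1 : 1 ≤ p := by omega
            have hpR : (0 : ℝ) < p := by exact_mod_cast hp1
            have hpq : (p : ℝ) ≤ q := by exact_mod_cast hp.2
            have h1 : (K : ℝ) ≤ scaleCount p := by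
              exact_mod_cast hcount.trans (scaleCount_mono (by omega))
            have h2 : (4 * q : ℝ)⁻¹ ≤ min (ψ p) (4 * p : ℝ)⁻¹ :=
              le_min (hψq.trans (hmono hp1 hq1 hp.2)) (by gcongr)
            exact mul_le_mul h2 h1 (Nat.cast_nonneg _) ((by positivity : (0 : ℝ) ≤ _).trans h2)
        _ ≤ _ := by
            refine Finset.sum_le_sum_of_subset_of_nonneg ?_
              fun q hq _ => hnn q (Finset.mem_Icc.mp hq).1
            intro p hp
            rw [Finset.mem_Ioc] at hp
            rw [Finset.mem_Icc]
            omega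
  · push Not at hbig
    obtain ⟨Q, hQ⟩ := hbig
    set D := ∑ q ∈ Finset.Icc 1 Q, ψ q * Real.log q
    have hlog : ∀ q, 1 ≤ q → 0 ≤ ψ q * Real.log q := fun q hq =>
      mul_nonneg (hψ q hq).le (Real.log_natCast_nonneg q)
    have hle : ∀ N : ℕ, (∑ q ∈ Finset.Icc 1 N, ψ q * Real.log q - D) / 4 ≤
        ∑ q ∈ Finset.Icc 1 N, min (ψ q) (4 * q : ℝ)⁻¹ * scaleCount q := by
      intro N
      have h1 : ∑ q ∈ Finset.Icc 1 N, ψ q * Real.log q ≤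
          ∑ q ∈ Finset.Icc 1 N, (4 * (min (ψ q) (4 * q : ℝ)⁻¹ * scaleCount q) +
            if q ≤ Q then ψ q * Real.log q else 0) := by
        refine Finset.sum_le_sum fun q hq => ?_
        have hq1 := (Finset.mem_Icc.mp hq).1
        split_ifs with h
        · linarith [hnn q hq1]
        · rw [min_eq_left (hQ q (by omega)).le]
          nlinarith [mul_le_mul_of_nonneg_left (log_le_scaleCount q hq1) (hψ q hq1).le]
      have h2 : (∑ q ∈ Finset.Icc 1 N, if q ≤ Q then ψ q * Real.log q else 0) ≤ D := by
        rw [← Finset.sum_filter]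
        refine Finset.sum_le_sum_of_subset_of_nonneg ?_
          fun q hq _ => hlog q (Finset.mem_Icc.mp hq).1
        intro q hq
        rw [Finset.mem_filter, Finset.mem_Icc] at hq
        exact Finset.mem_Icc.mpr ⟨hq.1.1, hq.2⟩
      rw [Finset.sum_add_distrib, ← Finset.mul_sum] at h1
      linarith
    refine tendsto_atTop_mono hle ?_
    exact (tendsto_atTop_add_const_right _ (-D) hdiv).atTop_div_const (by norm_num)

/-! ### The theorem on the torus. -/

/-- The inhomogeneous multiplicative approximation theorem on the torus, for `ψ q ≤ 1 / (4 * q)`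
with the logarithm replaced by the number of middle scales. -/
theorem ae_infinite_middleScales {ψ : ℕ → ℝ} (hψ0 : ∀ q, 1 ≤ q → 0 < ψ q)
    (hψ1 : ∀ q, 1 ≤ q → ψ q ≤ (4 * q : ℝ)⁻¹) (hmono : AntitoneOn ψ (Set.Ici 1))
    (hdiv : Tendsto (fun N : ℕ => ∑ q ∈ Finset.Icc 1 N, ψ q * scaleCount q) atTop atTop)
    (c c' : UnitAddCircle) :
    ∀ᵐ z : UnitAddCircle × UnitAddCircle,
      {q : ℕ | 1 ≤ q ∧ ‖q • z.1 - c‖ * ‖q • z.2 - c'‖ ≤ ψ q}.Infinite := by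
  obtain ⟨A, hA0, hA⟩ := exists_sum_gcd_mul_rpow_le (s := 17 / 16) (by norm_num)
  obtain ⟨B, hB0, hB⟩ := exists_sum_gcd_sq_mul_sqrt_le
  -- Inadmissible indices get the empty event, so every pair that occurs has `q ≥ 1` and a middle
  -- scale.
  let S : (Σ _ : ℕ, ℕ) → Set (UnitAddCircle × UnitAddCircle) := fun α =>
    {z | 1 ≤ α.1 ∧ α.2 ∈ middleScales α.1} ∩
      nearSet c α.1 (ψ α.1 * 2 ^ α.2) ×ˢ nearSet c' α.1 ((2 : ℝ) ^ α.2)⁻¹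
  let F : ℕ → Finset (Σ _ : ℕ, ℕ) := fun N => (Finset.Icc 1 N).sigma middleScales
  have hS : ∀ α, MeasurableSet (S α) := fun α =>
    (MeasurableSet.const _).inter ((measurableSet_nearSet _ _ _).prod (measurableSet_nearSet _ _ _))
  have hSeq : ∀ {q i : ℕ}, 1 ≤ q → i ∈ middleScales q →
      S ⟨q, i⟩ = nearSet c q (ψ q * 2 ^ i) ×ˢ nearSet c' q ((2 : ℝ) ^ i)⁻¹ := by
    intro q i hq hi
    simp [S, hq, hi]
  have hx0 : ∀ {q i : ℕ}, 1 ≤ q → 0 ≤ ψ q * 2 ^ i := fun {q i} hq =>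
    mul_nonneg (hψ0 q hq).le (by positivity)
  have hx1 : ∀ {q i : ℕ}, 1 ≤ q → i ∈ middleScales q → 2 * (ψ q * 2 ^ i) ≤ 1 := by
    intro q i hq hi
    have hqR : (1 : ℝ) ≤ q := by exact_mod_cast hq
    have h1 : ((2 : ℝ) ^ i) ^ 2 ≤ 4 * q := by exact_mod_cast two_pow_sq_middleScales_le hq hi
    have h2 : (2 : ℝ) ^ i ≤ 2 * q := by nlinarith [sq_nonneg ((2 : ℝ) ^ i - 2 * q)]
    calc 2 * (ψ q * 2 ^ i) ≤ 2 * ((4 * q : ℝ)⁻¹ * (2 * q)) := by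
          gcongr
          exact hψ1 q hq
      _ = 1 := by
          field_simp
          norm_num
  have hy1 : ∀ {q i : ℕ}, i ∈ middleScales q → 2 * ((2 : ℝ) ^ i)⁻¹ ≤ 1 := by
    intro q i hi
    have h1 : (2 : ℝ) ^ 1 ≤ 2 ^ i := pow_le_pow_right₀ one_le_two (one_le_middleScales hi)
    rw [← div_eq_mul_inv, div_le_one (by positivity)]
    linarith
  have hvol : ∀ {q i : ℕ}, 1 ≤ q → i ∈ middleScales q →
      (volume : Measure (UnitAddCircle × UnitAddCircle)).real (S ⟨q, i⟩) = 4 * ψ q := by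
    intro q i hq hi
    rw [hSeq hq hi, Measure.volume_eq_prod, measureReal_prod_prod,
      measureReal_nearSet c hq (hx0 hq) (hx1 hq hi),
      measureReal_nearSet c' hq (by positivity) (hy1 hi)]
    field_simp
    ring
  have hsum : ∀ N, ∑ α ∈ F N, (volume : Measure (UnitAddCircle × UnitAddCircle)).real (S α) =
      4 * ∑ q ∈ Finset.Icc 1 N, ψ q * scaleCount q := by
    intro N
    simp only [F]
    rw [Finset.sum_sigma, Finset.mul_sum]
    refine Finset.sum_congr rfl fun q hq => ?_
    rw [Finset.sum_congr rfl fun i hi => hvol (Finset.mem_Icc.mp hq).1 hi, Finset.sum_const,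
      card_middleScales, nsmul_eq_mul]
    ring
  have hpair : ∀ {q r i j : ℕ}, 1 ≤ q → 1 ≤ r → i ∈ middleScales q → j ∈ middleScales r →
      (volume : Measure (UnitAddCircle × UnitAddCircle)).real (S ⟨q, i⟩ ∩ S ⟨r, j⟩) ≤
      (4 * ψ q) * (4 * ψ r) + 8 * (Nat.gcd q r *
        ((ψ q * 2 ^ i) * (ψ r * 2 ^ j) * min (((2 : ℝ) ^ i)⁻¹ / q) (((2 : ℝ) ^ j)⁻¹ / r))) +
      8 * (Nat.gcd q r *
        (((2 : ℝ) ^ i)⁻¹ * ((2 : ℝ) ^ j)⁻¹ * min (ψ q * 2 ^ i / q) (ψ r * 2 ^ j / r))) +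
      4 * ((Nat.gcd q r : ℝ) ^ 2 * (min (ψ q * 2 ^ i / q) (ψ r * 2 ^ j / r) *
        min (((2 : ℝ) ^ i)⁻¹ / q) (((2 : ℝ) ^ j)⁻¹ / r))) := by
    intro q r i j hq hr hi hj
    rw [hSeq hq hi, hSeq hr hj, Set.prod_inter_prod, Measure.volume_eq_prod, measureReal_prod_prod]
    have h1 := measureReal_nearSet_inter_le c hq hr (hx0 hq) (hx1 hq hi) (hx0 hr) (hx1 hr hj)
    have h2 := measureReal_nearSet_inter_le c' hq hr (by positivity) (hy1 hi) (by positivity)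
      (hy1 hj)
    refine (mul_le_mul h1 h2 measureReal_nonneg (measureReal_nonneg.trans h1)).trans
      (le_of_eq ?_)
    have h3 : ψ q * 2 ^ i * (ψ r * 2 ^ j) * (((2 : ℝ) ^ i)⁻¹ * ((2 : ℝ) ^ j)⁻¹) = ψ q * ψ r := by
      field_simp
    linear_combination 16 * h3
  have hψ0' : ∀ q, 1 ≤ q → 0 ≤ ψ q := fun q hq => (hψ0 q hq).le
  have hcorr : ∀ N, ∑ α ∈ F N, ∑ β ∈ F N,
      (volume : Measure (UnitAddCircle × UnitAddCircle)).real (S α ∩ S β) ≤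
      (∑ α ∈ F N, (volume : Measure (UnitAddCircle × UnitAddCircle)).real (S α)) ^ 2 +
      -- `1296 = 2 * 8 * 81` collects the two mixed terms; the double gcd term has constant `24 = 4
      -- * 6`, and `24 * B * Ψ` is `6 * B` times the mean `4 * Ψ`.
      (1296 * A + 6 * B) *
        (∑ α ∈ F N, (volume : Measure (UnitAddCircle × UnitAddCircle)).real (S α)) +
      (1296 * A + 6 * B) := by
    intro N
    rw [hsum]
    set Ψ := ∑ q ∈ Finset.Icc 1 N, ψ q * scaleCount q with hΨ
    have hΨ0 : 0 ≤ Ψ := Finset.sum_nonneg fun q hq =>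
      mul_nonneg (hψ0' q (Finset.mem_Icc.mp hq).1) (Nat.cast_nonneg _)
    have hblock : ∀ q ∈ Finset.Icc 1 N, ∀ r ∈ Finset.Icc 1 N,
        ∑ i ∈ middleScales q, ∑ j ∈ middleScales r,
          (volume : Measure (UnitAddCircle × UnitAddCircle)).real (S ⟨q, i⟩ ∩ S ⟨r, j⟩) ≤
        16 * ((ψ q * scaleCount q) * (ψ r * scaleCount r)) +
          1296 * ((Nat.gcd q r : ℝ) * ((q : ℝ) * r) ^ (-(17 / 16) : ℝ)) +
          24 * ((Nat.gcd q r : ℝ) ^ 2 / (q * r) *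
            (√(ψ q * scaleCount q) * √(ψ r * scaleCount r))) := by
      intro q hq r hr
      have hq1 := (Finset.mem_Icc.mp hq).1
      have hr1 := (Finset.mem_Icc.mp hr).1
      have h1 := sum_sum_mul_min_inv_le hψ0' hψ1 hq1 hr1
      have h2 := sum_sum_inv_mul_min_le hψ0' hψ1 hq1 hr1
      have h3 := sum_sum_min_mul_min_le hψ0 hq1 hr1
      refine (Finset.sum_le_sum fun i hi => Finset.sum_le_sum fun j hj =>
        hpair hq1 hr1 hi hj).trans ?_
      simp only [Finset.sum_add_distrib, ← Finset.mul_sum, Finset.sum_const, card_middleScales,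
        nsmul_eq_mul]
      have hg : (0 : ℝ) ≤ Nat.gcd q r := Nat.cast_nonneg _
      have h1' := mul_le_mul_of_nonneg_left h1 hg
      have h2' := mul_le_mul_of_nonneg_left h2 hg
      have h3' := mul_le_mul_of_nonneg_left h3 (sq_nonneg (Nat.gcd q r : ℝ))
      rw [div_eq_mul_inv ((Nat.gcd q r : ℝ) ^ 2)]
      linarith
    calc _ = ∑ q ∈ Finset.Icc 1 N, ∑ r ∈ Finset.Icc 1 N,
          ∑ i ∈ middleScales q, ∑ j ∈ middleScales r,
          (volume : Measure (UnitAddCircle × UnitAddCircle)).real (S ⟨q, i⟩ ∩ S ⟨r, j⟩) := by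
          simp only [F, Finset.sum_sigma]
          refine Finset.sum_congr rfl fun q _ => ?_
          rw [Finset.sum_comm]
      _ ≤ _ := Finset.sum_le_sum fun q hq => Finset.sum_le_sum fun r hr => hblock q hq r hr
      _ = 16 * (Ψ * Ψ) + 1296 * ∑ q ∈ Finset.Icc 1 N, ∑ r ∈ Finset.Icc 1 N,
            (Nat.gcd q r : ℝ) * ((q : ℝ) * r) ^ (-(17 / 16) : ℝ) +
          24 * ∑ q ∈ Finset.Icc 1 N, ∑ r ∈ Finset.Icc 1 N,
            (Nat.gcd q r : ℝ) ^ 2 / (q * r) *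
              (√(ψ q * scaleCount q) * √(ψ r * scaleCount r)) := by
          simp only [Finset.sum_add_distrib, ← Finset.mul_sum]
          rw [hΨ, Finset.sum_mul]
      _ ≤ 16 * (Ψ * Ψ) + 1296 * A + 24 * (B * Ψ) := by
          gcongr
          · exact hA N
          · refine hB (fun q => ψ q * scaleCount q)
              (fun q hq => mul_nonneg (hψ0' q hq) (Nat.cast_nonneg _)) (fun p q hp hpq hqp => ?_) N
            have h1 : ψ q ≤ ψ p := hmono hp (hp.trans hpq) hpq
            have h2 : (scaleCount q : ℝ) ≤ 2 * scaleCount p := by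
              exact_mod_cast scaleCount_le_two_mul hp hqp
            calc ψ q * scaleCount q ≤ ψ p * (2 * scaleCount p) := by
                  gcongr
                  exact hψ0' p hp
              _ = 2 * (ψ p * scaleCount p) := by ring
      _ ≤ _ := by nlinarith [mul_nonneg hA0 hΨ0, mul_nonneg hB0 hΨ0]
  have hE : Tendsto (fun N => ∑ α ∈ F N,
      (volume : Measure (UnitAddCircle × UnitAddCircle)).real (S α)) atTop atTop := by
    simp only [hsum]
    exact hdiv.const_mul_atTop (by norm_num)
  have : IsProbabilityMeasure (volume : Measure UnitAddCircle) := ⟨UnitAddCircle.measure_univ⟩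
  have : IsProbabilityMeasure (volume : Measure (UnitAddCircle × UnitAddCircle)) := by
    rw [Measure.volume_eq_prod]
    infer_instance
  filter_upwards [ae_infinite_of_sum_measureReal_inter_le volume S hS F _ hE hcorr] with z hz hfin
  -- Each `q` has finitely many scales, so infinitely many pairs force infinitely many `q`.
  refine hz ((hfin.toFinset.sigma middleScales).finite_toSet.subset ?_)
  rintro ⟨q, i⟩ ⟨⟨hq, hi⟩, hzx, hzy⟩
  simp only [Finset.coe_sigma, Set.mem_sigma_iff, Finset.mem_coe, Set.Finite.mem_toFinset]
  refine ⟨⟨hq, ?_⟩, hi⟩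
  have h1 : ‖q • z.1 - c‖ ≤ ψ q * 2 ^ i := hzx
  have h2 : ‖q • z.2 - c'‖ ≤ ((2 : ℝ) ^ i)⁻¹ := hzy
  calc _ ≤ ψ q * 2 ^ i * ((2 : ℝ) ^ i)⁻¹ := mul_le_mul h1 h2 (norm_nonneg _) (hx0 hq)
    _ = ψ q := by field_simp

/-! ### Transfer from the torus to the unit square. -/

theorem norm_nsmul_coe_sub_coe (q : ℕ) (x c : ℝ) :
    ‖q • (x : UnitAddCircle) - (c : UnitAddCircle)‖ = distToInt (q * x - c) := by
  rw [distToInt_eq_abs_sub_round, ← UnitAddCircle.norm_eq, AddCircle.coe_sub, ← nsmul_eq_mul,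
    AddCircle.coe_nsmul]

theorem corollary1p1 (ψ : ℕ → ℝ) (hψ : IsApproximationFunction ψ)
    (hmono : AntitoneOn ψ (Set.Ici 1))
    (hdiv : Filter.Tendsto (fun N : ℕ => ∑ q ∈ Finset.Icc 1 N, ψ q * Real.log q)
      Filter.atTop Filter.atTop)
    (γ : ℝ) (hγ : ¬ Liouville γ) (γ' : ℝ) :
    ∀ᵐ p : ℝ × ℝ ∂(MeasureTheory.volume.restrict (Set.Icc (0 : ℝ) 1 ×ˢ Set.Icc (0 : ℝ) 1)),
      {q : ℕ | 1 ≤ q ∧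
        distToInt (q * p.1 - γ) * distToInt (q * p.2 - γ') ≤ ψ q}.Infinite := by
  have htorus := ae_infinite_middleScales (ψ := fun q => min (ψ q) (4 * q : ℝ)⁻¹)
    (fun q hq => lt_min (hψ q hq) (by
      have : (0 : ℝ) < q := by exact_mod_cast hq
      positivity))
    (fun q _ => min_le_right _ _)
    (fun p hp q hq hpq => min_le_min (hmono hp hq hpq) (by
      have h1 : (0 : ℝ) < p := by exact_mod_cast (hp : 1 ≤ p)
      have h2 : (p : ℝ) ≤ q := by exact_mod_cast hpq
      gcongr))
    (tendsto_sum_min_mul_scaleCount hψ hmono hdiv) (γ : UnitAddCircle) (γ' : UnitAddCircle)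
  have hmk : MeasurePreserving ((↑) : ℝ → UnitAddCircle) (volume.restrict (Set.Icc (0 : ℝ) 1))
      volume := by
    have h := UnitAddCircle.measurePreserving_mk 0
    rwa [zero_add, Measure.restrict_congr_set Ioc_ae_eq_Icc] at h
  rw [Measure.volume_eq_prod, ← Measure.prod_restrict]
  have hpull := (hmk.prod hmk).quasiMeasurePreserving.ae htorus
  filter_upwards [hpull] with p hp
  refine hp.mono fun q hq => ⟨hq.1, ?_⟩
  rw [← norm_nsmul_coe_sub_coe, ← norm_nsmul_coe_sub_coe]
  exact hq.2.trans (min_le_left _ _)
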